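/- Let $B$ be a finite bidirected graph, that is, a finite loopless multigraph in which every half-edge $(e,u)$ ($u$ an endpoint of the edge $e$) carries a sign $\sigma(e,u)\in\{+,-\}$. An oriented edge is an edge together with a choice of one endpoint as its tail and the other as its head. A trail is a sequence $v_0\,\vec e_1\,v_1\dots\vec e_\ell\,v_\ell$ ($\ell\ge 0$) of vertices and oriented edges whose underlying edges $e_1,\dots,e_\ell$ are distinct, such that $\vec e_i$ has tail $v_{i-1}$ and head $v_i$ for $1\le i\le \ell$ and $\sigma(e_{i+1},v_i)=-\sigma(e_i,v_i)$ for $1\le i<\ell$; it is a $v_0$--$v_\ell$ trail, nontrivial if $\ell\ge 1$. A path is a trail that does not repeat vertices. An almost path is a trail that is trivial or becomes a path when its last edge and last vertex are removed. For a vertex $r$, the graph $B$ rooted at $r$ is called clean if it has no nontrivial $r$--$r$ almost path. Suppose that $B$ rooted at $r$ is clean, and let $x\neq r$ be a vertex such that there is no edge between $r$ and $x$. Let $\kappa_B(r,x)$ be the maximum number of pairwise internally vertex-disjoint $r$--$x$ paths. Let $N(x)$ be the set of vertices $v\notin\{r,x\}$ that are the second to last vertex of some $r$--$x$ path. For $X\subseteq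 V(B)\setminus\{r\}$ let $\varepsilon_{r,B}(X)$ be the set of vertices $v\in X$ for which there is an oriented edge $\vec e$ with head $v$ and tail not in $X$ that is the last edge of some path starting at $r$. Then $$\kappa_B(r,x)=\min\bigl\{\,|\varepsilon_{r,B}(X)| \;:\; \{x\}\cup N(x)\subseteq X\subseteq V(B)\setminus\{r\}\,\bigr\}.$$ -/

import Mathlib

/-- A bidirected graph with vertex set `V` and edge set `E`: a loopless multigraph together with
a sign (`1` or `-1`, as an element of `ℤˣ`) for every half-edge `(e, u)`, `u` an endpoint of `e`. -/
structure BidirectedGraph (V E : Type*) where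
  /-- the unordered pair of endpoints of an edge -/
  ends : E → Sym2 V
  /-- there are no loops -/
  loopless : ∀ e, ¬ (ends e).IsDiag
  /-- the sign of each half-edge -/
  sign : {h : E × V // h.2 ∈ ends h.1} → ℤˣ

namespace BidirectedGraph

variable {V E : Type*}

/-- An oriented edge `(e, u, v)`: an edge `e` with endpoints `u` (its tail) and `v` (its head). -/
structure OrientedEdge (B : BidirectedGraph V E) where
  edge : E
  tail : V
  head : V
  ends_eq : B.ends edge = s(tail, head)

variable {B : BidirectedGraph V E}

/-- The sign of the underlying edge at the tail. -/
def OrientedEdge.tailSign (f : B.OrientedEdge) : ℤˣ :=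
  B.sign ⟨(f.edge, f.tail), by simp [f.ends_eq]⟩

/-- The sign of the underlying edge at the head. -/
def OrientedEdge.headSign (f : B.OrientedEdge) : ℤˣ :=
  B.sign ⟨(f.edge, f.head), by simp [f.ends_eq]⟩

variable (B)

/-- `B.IsWalk u T v`: starting at `u` and following the oriented edges in the list `T` one after
another, each starting where the previous one ended, leads to `v`. -/
def IsWalk : V → List B.OrientedEdge → V → Prop
  | u, [], v => u = v
  | u, f :: T, v => f.tail = u ∧ IsWalk f.head T v

/-- The sequence of vertices visited when following `T` from `u`, including both ends. -/
def vertices (u : V) (T : List B.OrientedEdge) : List V :=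
  u :: T.map OrientedEdge.head

/-- The internal vertices, that is, all but the first and the last one. -/
def interior (T : List B.OrientedEdge) : List V :=
  (T.map OrientedEdge.head).dropLast

/-- `T` is a `u`--`v` trail: no edge is repeated, and the sign is switched at every internal
vertex. The empty list is the trivial trail. -/
structure IsTrail (u : V) (T : List B.OrientedEdge) (v : V) : Prop where
  isWalk : B.IsWalk u T v
  edges_nodup : (T.map OrientedEdge.edge).Nodup
  switch : T.IsChain (fun f g => g.tailSign = -f.headSign)

/-- `T` is a `u`--`v` path: a trail that does not repeat vertices. -/
structure IsPath (u : V) (T : List B.OrientedEdge) (v : V) : Prop where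
  isTrail : B.IsTrail u T v
  vertices_nodup : (B.vertices u T).Nodup

/-- `T` is a `u`--`v` almost path: a trail that is trivial or becomes a path when its last edge
(and last vertex) is removed. -/
def IsAlmostPath (u : V) (T : List B.OrientedEdge) (v : V) : Prop :=
  B.IsTrail u T v ∧ (T = [] ∨ ∃ w, B.IsPath u T.dropLast w)

/-- `B` rooted at `r` is clean: there is no nontrivial `r`--`r` almost path. -/
def IsClean (r : V) : Prop :=
  ¬ ∃ T : List B.OrientedEdge, T ≠ [] ∧ B.IsAlmostPath r T r

/-- `P` is a set of pairwise internally vertex-disjoint `u`--`v` paths. -/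
def IsInternallyDisjoint (u v : V) (P : Set (List B.OrientedEdge)) : Prop :=
  (∀ T ∈ P, B.IsPath u T v) ∧
    P.Pairwise fun S T => List.Disjoint (B.interior S) (B.interior T)

/-- `κ_B(u, v)`: the largest number of internally vertex-disjoint `u`--`v` paths. -/
noncomputable def kappa (u v : V) : ℕ∞ :=
  ⨆ P : {P : Set (List B.OrientedEdge) // B.IsInternallyDisjoint u v P}, P.1.encard

/-- The vertices `v ∉ {r, x}` that are the second to last vertex of some `r`--`x` path. -/
def inVertices (r x : V) : Set V :=
  {v | v ≠ r ∧ v ≠ x ∧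
    ∃ (T : List B.OrientedEdge) (f : B.OrientedEdge), B.IsPath r (T ++ [f]) x ∧ f.tail = v}

/-- `ε_{r,B}(X)`: the vertices `v ∈ X` that are the head of an oriented edge `f` whose tail is not
in `X` and which is the terminal edge of some path starting at `r`. -/
def entryVertices (r : V) (X : Set V) : Set V :=
  {v | v ∈ X ∧ ∃ f : B.OrientedEdge, f.head = v ∧ f.tail ∉ X ∧
    ∃ T : List B.OrientedEdge, B.IsPath r (T ++ [f]) v}

end BidirectedGraph

/-! Disjoint paths enter `X` at distinct vertices, which gives one inequality
(`IsInternallyDisjoint.encard_le`). For equality, cleanness is turned into structure by matching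
theory, reducing the problem to Menger's theorem for digraphs.

Split each vertex into its two signed halves. Superposing a perfect matching of the split graph on
the pairs of halves would give an alternating cycle through the root, which reads as a nontrivial
`r`--`r` almost path. So a clean graph has no perfect matching, and Tutte's theorem gives a violator
`U`. By parity at least `|U| + 2` odd components remain. An odd component is not closed under
swapping halves, so it contains a half of `r` or the partner of an element of `U`; this allows at
most `|U| + 2` of them. Equality makes the assignment bijective: each element of `U`, and each half
of `r`, has its own component (`IsBarrier`).

The components thus cut the vertices into blobs with at most one base each. A path from `r` can
enter a new blob only at its base, through a half in `U` (`exists_decomposition`), so it is a chain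
of segments between bases. Conversely, segments along a directed path of bases concatenate to a
path, since distinct bases have distinct blobs (`exists_isPath_of_route`). If `x` is a base,
Menger's theorem in the digraph of segments yields the paths and a separator from which `X` is
built. Otherwise the blob of `x` is a suitable `X` whenever `x` is reachable, with one entry vertex.
-/

/-! ### Directed paths and Menger's theorem -/

/-- A directed path of the relation `R` from its first to its third argument with vertex set the
second argument. -/
inductive Route {V : Type*} (R : V → V → Prop) : V → Set V → V → Prop
  | refl (a : V) : Route R a {a} a
  | snoc {a b c : V} {s : Set V} : Route R a s b → R b c → c ∉ s → Route R a (insert c s) c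

namespace Route

variable {V : Type*} {R R' : V → V → Prop} {a b c z : V} {s t S : Set V}

theorem left_mem (h : Route R a s b) : a ∈ s := by
  induction h with
  | refl => simp
  | snoc _ _ _ ih => exact Set.mem_insert_of_mem _ ih

theorem right_mem (h : Route R a s b) : b ∈ s := by
  cases h <;> simp

theorem mono (hR : ∀ u v, R u v → R' u v) (h : Route R a s b) : Route R' a s b := by
  induction h with
  | refl => exact refl _
  | snoc _ hbc hc ih => exact ih.snoc (hR _ _ hbc) hc

theorem trans (h : Route R a s b) (h' : Route R b t c) (hst : ∀ v ∈ s, v ∈ t → v = b) :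
    Route R a (s ∪ t) c := by
  induction h' with
  | refl => simpa [Set.union_eq_self_of_subset_right (Set.singleton_subset_iff.2 h.right_mem)]
      using h
  | @snoc d e t h' hde he ih =>
    rw [Set.union_insert]
    refine (ih fun v hv hv' => hst v hv (Set.mem_insert_of_mem _ hv')).snoc hde ?_
    rintro (hs | ht)
    · exact he (hst e hs (Set.mem_insert _ _) ▸ h'.left_mem)
    · exact he ht

theorem split (h : Route R a s b) (hz : z ∈ s) :
    ∃ s₁ s₂, Route R a s₁ z ∧ Route R z s₂ b ∧ s₁ ⊆ s ∧ s₂ ⊆ s ∧ ∀ v ∈ s₁, v ∈ s₂ → v = z := by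
  induction h with
  | refl =>
    obtain rfl := hz
    exact ⟨_, _, refl _, refl _, subset_rfl, subset_rfl, fun v hv _ => hv⟩
  | @snoc d e t h hde he ih =>
    by_cases hze : z = e
    · subst hze
      exact ⟨_, _, h.snoc hde he, refl _, subset_rfl, by simp, fun v _ hv => hv⟩
    · obtain ⟨s₁, s₂, h₁, h₂, hs₁, hs₂, h12⟩ := ih (hz.resolve_left hze)
      refine ⟨s₁, insert e s₂, h₁, h₂.snoc hde fun h => he (hs₂ h),
        hs₁.trans (Set.subset_insert _ _), Set.insert_subset_insert hs₂, ?_⟩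
      rintro v hv (rfl | hv')
      · exact absurd (hs₁ hv) he
      · exact h12 v hv hv'

theorem exists_subset_trans (h : Route R a s b) (h' : Route R b t c) :
    ∃ u ⊆ s ∪ t, Route R a u c := by
  induction h' with
  | refl => exact ⟨s, Set.subset_union_left, h⟩
  | @snoc d e t h' hde he ih =>
    obtain ⟨u, hu, hr⟩ := ih
    by_cases heu : e ∈ u
    · obtain ⟨s₁, -, h₁, -, hs₁, -⟩ := hr.split heu
      exact ⟨s₁, hs₁.trans (hu.trans (Set.union_subset_union_right _ (Set.subset_insert _ _))), h₁⟩
    · refine ⟨_, ?_, hr.snoc hde heu⟩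
      rw [Set.union_insert]
      exact Set.insert_subset_insert hu

theorem exists_first (h : Route R a s b) (hS : (s ∩ S).Nonempty) :
    ∃ s' c, Route R a s' c ∧ s' ⊆ s ∧ c ∈ S ∧ ∀ v ∈ s', v ∈ S → v = c := by
  induction h with
  | refl =>
    obtain ⟨v, hv, hvS⟩ := hS
    obtain rfl := hv
    exact ⟨_, _, refl _, subset_rfl, hvS, fun v hv _ => hv⟩
  | @snoc d e t h hde he ih =>
    by_cases ht : (t ∩ S).Nonempty
    · obtain ⟨s', c, h', hs, hc⟩ := ih ht
      exact ⟨s', c, h', hs.trans (Set.subset_insert _ _), hc⟩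
    · have hn : ∀ v ∈ t, v ∉ S := fun v hv hvS => ht ⟨v, hv, hvS⟩
      obtain ⟨v, rfl | hv, hvS⟩ := hS
      · refine ⟨_, _, h.snoc hde he, subset_rfl, hvS, ?_⟩
        rintro w (rfl | hw) hwS
        · rfl
        · exact absurd hwS (hn w hw)
      · exact absurd hvS (hn v hv)

theorem exists_last (h : Route R a s b) (hS : (s ∩ S).Nonempty) :
    ∃ s' c, Route R c s' b ∧ s' ⊆ s ∧ c ∈ S ∧ ∀ v ∈ s', v ∈ S → v = c := by
  induction h with
  | refl =>
    obtain ⟨v, hv, hvS⟩ := hS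
    obtain rfl := hv
    exact ⟨_, _, refl _, subset_rfl, hvS, fun v hv _ => hv⟩
  | @snoc d e t h hde he ih =>
    by_cases heS : e ∈ S
    · exact ⟨_, _, refl e, by simp, heS, fun v hv _ => hv⟩
    · have ht : (t ∩ S).Nonempty := by
        obtain ⟨v, rfl | hv, hvS⟩ := hS
        · exact absurd hvS heS
        · exact ⟨v, hv, hvS⟩
      obtain ⟨s', c, h', hs, hc, hu⟩ := ih ht
      refine ⟨_, c, h'.snoc hde fun h => he (hs h), Set.insert_subset_insert hs, hc, ?_⟩
      rintro v (rfl | hv) hvS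
      · exact absurd hvS heS
      · exact hu v hv hvS

/-- A route that meets `x` at most at its end never leaves `x`, so it survives deletion of the edge
from `x` to `y`. -/
theorem of_notMem_tail {x y : V} (hR : ∀ u v, R u v → u ≠ x ∨ v ≠ y → R' u v)
    (h : Route R a s b) (hx : x ∈ s → x = b) : Route R' a s b := by
  induction h with
  | refl => exact refl _
  | @snoc d e t h hde he ih =>
    have hxt : x ∉ t := fun h => he (hx (Set.mem_insert_of_mem _ h) ▸ h)
    refine (ih fun h => absurd h hxt).snoc (hR _ _ hde (Or.inl ?_)) he
    rintro rfl
    exact hxt h.right_mem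

theorem of_notMem_head {x y : V} (hR : ∀ u v, R u v → u ≠ x ∨ v ≠ y → R' u v)
    (h : Route R a s b) (hy : y ∈ s → y = a) : Route R' a s b := by
  induction h with
  | refl => exact refl _
  | @snoc d e t h hde he ih =>
    refine (ih fun h => hy (Set.mem_insert_of_mem _ h)).snoc (hR _ _ hde (Or.inr ?_)) he
    rintro rfl
    exact he (hy (Set.mem_insert _ _) ▸ h.left_mem)

end Route

/-- Every `R`-path from `A` to `C` meets `S`. -/
def Separates {V : Type*} (R : V → V → Prop) (A C : Set V) (S : Set V) : Prop :=
  ∀ a ∈ A, ∀ c ∈ C, ∀ s, Route R a s c → (s ∩ S).Nonempty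

/-- There is a family of disjoint `R`-paths from `A` to `C` indexed by `ι`. -/
def Linked {V : Type*} (R : V → V → Prop) (A C : Set V) (ι : Type*) : Prop :=
  ∃ P : ι → Set V, (∀ i, ∃ a ∈ A, ∃ c ∈ C, Route R a (P i) c) ∧
    Pairwise fun i j => Disjoint (P i) (P j)

theorem Linked.comp {V ι κ : Type*} {R : V → V → Prop} {A C : Set V} (h : Linked R A C ι)
    {f : κ → ι} (hf : Function.Injective f) : Linked R A C κ := by
  obtain ⟨P, hP, hd⟩ := h
  exact ⟨P ∘ f, fun i => hP _, fun i j hij => hd (hf.ne hij)⟩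

theorem Linked.mono {V ι : Type*} {R R' : V → V → Prop} {A C : Set V}
    (hR : ∀ u v, R u v → R' u v) (h : Linked R A C ι) : Linked R' A C ι := by
  obtain ⟨P, hP, hd⟩ := h
  refine ⟨P, fun i => ?_, hd⟩
  obtain ⟨a, ha, c, hc, hr⟩ := hP i
  exact ⟨a, ha, c, hc, hr.mono hR⟩

section
variable {V : Type*} {R : V → V → Prop} {A C : Set V} {T : Finset V}

/-- Cut each path at its first vertex in `T`. The ends are then distinct, and as there are `T.card`
of them they exhaust `T`, so the paths can be indexed by their ends. -/
theorem Linked.exists_paths_to (h : Linked R A T (Fin T.card)) :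
    ∃ P : V → Set V, (∀ t ∈ T, (∃ a ∈ A, Route R a (P t) t) ∧ ∀ v ∈ P t, v ∈ T → v = t) ∧
      ∀ t ∈ T, ∀ t' ∈ T, t ≠ t' → Disjoint (P t) (P t') := by
  obtain ⟨P, hP, hd⟩ := h
  have hP' : ∀ i, ∃ s' c, c ∈ T ∧ (∃ a ∈ A, Route R a s' c) ∧ s' ⊆ P i ∧
      ∀ v ∈ s', v ∈ T → v = c := fun i => by
    obtain ⟨a, ha, c, hc, hr⟩ := hP i
    obtain ⟨s', c', h1, h2, h3, h4⟩ := hr.exists_first ⟨c, hr.right_mem, hc⟩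
    exact ⟨s', c', h3, ⟨a, ha, h1⟩, h2, h4⟩
  choose P' e heT ha hsub huniq using hP'
  have hinj : Function.Injective fun i => (⟨e i, heT i⟩ : T) := by
    intro i j hij
    by_contra hne
    have hij' : e i = e j := congrArg Subtype.val hij
    obtain ⟨_, _, h1⟩ := ha i
    obtain ⟨_, _, h2⟩ := ha j
    exact Set.disjoint_left.1 (hd hne) (hsub i h1.right_mem) (hsub j (hij' ▸ h2.right_mem))
  have hsurj := ((Fintype.bijective_iff_injective_and_card _).2 ⟨hinj, by simp⟩).2
  have hg : ∀ t : T, ∃ i, e i = t := fun t => by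
    obtain ⟨i, hi⟩ := hsurj t
    exact ⟨i, congrArg Subtype.val hi⟩
  choose g hg using hg
  classical
  refine ⟨fun t => if ht : t ∈ T then P' (g ⟨t, ht⟩) else ∅, fun t ht => ?_, ?_⟩
  · simp only [ht, dif_pos]
    have h1 := ha (g ⟨t, ht⟩)
    have h2 := huniq (g ⟨t, ht⟩)
    rw [hg] at h1 h2
    exact ⟨h1, h2⟩
  · intro t ht t' ht' hne
    simp only [ht, ht', dif_pos]
    refine (hd fun h => hne ?_).mono (hsub _) (hsub _)
    have := congrArg e h
    rwa [hg, hg] at this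

theorem Linked.exists_paths_from (h : Linked R T C (Fin T.card)) :
    ∃ P : V → Set V, (∀ t ∈ T, (∃ c ∈ C, Route R t (P t) c) ∧ ∀ v ∈ P t, v ∈ T → v = t) ∧
      ∀ t ∈ T, ∀ t' ∈ T, t ≠ t' → Disjoint (P t) (P t') := by
  obtain ⟨P, hP, hd⟩ := h
  have hP' : ∀ i, ∃ s' c, c ∈ T ∧ (∃ a ∈ C, Route R c s' a) ∧ s' ⊆ P i ∧
      ∀ v ∈ s', v ∈ T → v = c := fun i => by
    obtain ⟨a, ha, c, hc, hr⟩ := hP i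
    obtain ⟨s', c', h1, h2, h3, h4⟩ := hr.exists_last ⟨a, hr.left_mem, ha⟩
    exact ⟨s', c', h3, ⟨c, hc, h1⟩, h2, h4⟩
  choose P' e heT ha hsub huniq using hP'
  have hinj : Function.Injective fun i => (⟨e i, heT i⟩ : T) := by
    intro i j hij
    by_contra hne
    have hij' : e i = e j := congrArg Subtype.val hij
    obtain ⟨_, _, h1⟩ := ha i
    obtain ⟨_, _, h2⟩ := ha j
    exact Set.disjoint_left.1 (hd hne) (hsub i h1.left_mem) (hsub j (hij' ▸ h2.left_mem))
  have hsurj := ((Fintype.bijective_iff_injective_and_card _).2 ⟨hinj, by simp⟩).2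
  have hg : ∀ t : T, ∃ i, e i = t := fun t => by
    obtain ⟨i, hi⟩ := hsurj t
    exact ⟨i, congrArg Subtype.val hi⟩
  choose g hg using hg
  classical
  refine ⟨fun t => if ht : t ∈ T then P' (g ⟨t, ht⟩) else ∅, fun t ht => ?_, ?_⟩
  · simp only [ht, dif_pos]
    have h1 := ha (g ⟨t, ht⟩)
    have h2 := huniq (g ⟨t, ht⟩)
    rw [hg] at h1 h2
    exact ⟨h1, h2⟩
  · intro t ht t' ht' hne
    simp only [ht, ht', dif_pos]
    refine (hd fun h => hne ?_).mono (hsub _) (hsub _)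
    have := congrArg e h
    rwa [hg, hg] at this

end

/-- Induction on the edges. If deleting the edge `(x, y)` leaves a separator `S` with fewer than `k`
vertices, then `S ∪ {x}` and `S ∪ {y}` separate in the full graph and have exactly `k` vertices.
Linkages from `A` to the first and from the second to `C` exist without the edge and are glued along
`S` and the edge. -/
theorem linked_of_forall_separates {V : Type*} [Finite V] (F : Finset (V × V)) :
    ∀ (A C : Set V) (k : ℕ),
      (∀ S : Finset V, Separates (fun u v => (u, v) ∈ F) A C S → k ≤ S.card) →
        Linked (fun u v => (u, v) ∈ F) A C (Fin k) := by
  classical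
  cases nonempty_fintype V
  induction F using Finset.induction_on with
  | empty =>
    intro A C k hk
    have h := hk (Finset.univ.filter (· ∈ A ∩ C)) fun a ha c hc s hr => by
      cases hr with
      | refl => exact ⟨a, rfl, by simp [ha, hc]⟩
      | snoc _ h _ => simp at h
    have hcard : Fintype.card (Fin k) ≤
        Fintype.card (Finset.univ.filter (· ∈ A ∩ C) : Finset V) := by
      rwa [Fintype.card_fin, Fintype.card_coe]
    obtain ⟨f⟩ := Function.Embedding.nonempty_of_card_le hcard
    have hf : ∀ i, (f i : V) ∈ A ∩ C := fun i => (Finset.mem_filter.1 (f i).2).2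
    refine ⟨fun i => {(f i : V)}, fun i => ⟨_, (hf i).1, _, (hf i).2, .refl _⟩, fun i j hij => ?_⟩
    exact Set.disjoint_singleton.2 fun h => hij (f.injective (Subtype.ext h))
  | insert e F he ih =>
    obtain ⟨x, y⟩ := e
    intro A C k hk
    have hFR : ∀ u v, (u, v) ∈ F → (u, v) ∈ insert (x, y) F := fun u v h =>
      Finset.mem_insert_of_mem h
    have hRF : ∀ u v, (u, v) ∈ insert (x, y) F → u ≠ x ∨ v ≠ y → (u, v) ∈ F := by
      intro u v h hne
      rcases Finset.mem_insert.1 h with h | h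
      · simp only [Prod.mk.injEq] at h
        tauto
      · exact h
    by_cases hF : ∀ S : Finset V, Separates (fun u v => (u, v) ∈ F) A C S → k ≤ S.card
    · exact (ih A C k hF).mono hFR
    push Not at hF
    obtain ⟨S, hS, hSk⟩ := hF
    have hSx : Separates (fun u v => (u, v) ∈ insert (x, y) F) A C ↑(insert x S) := by
      intro a ha c hc s hr
      by_cases hx : x ∈ s
      · exact ⟨x, hx, by simp⟩
      · obtain ⟨v, hv, hvS⟩ := hS a ha c hc s (hr.of_notMem_tail hRF fun h => absurd h hx)
        exact ⟨v, hv, by simpa using Or.inr hvS⟩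
    have hSy : Separates (fun u v => (u, v) ∈ insert (x, y) F) A C ↑(insert y S) := by
      intro a ha c hc s hr
      by_cases hy : y ∈ s
      · exact ⟨y, hy, by simp⟩
      · obtain ⟨v, hv, hvS⟩ := hS a ha c hc s (hr.of_notMem_head hRF fun h => absurd h hy)
        exact ⟨v, hv, by simpa using Or.inr hvS⟩
    have hxk : (insert x S).card = k :=
      le_antisymm ((Finset.card_insert_le _ _).trans hSk) (hk _ hSx)
    have hyk : (insert y S).card = k :=
      le_antisymm ((Finset.card_insert_le _ _).trans hSk) (hk _ hSy)
    have hxS : x ∉ S := fun h => by rw [Finset.insert_eq_of_mem h] at hxk; omega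
    have hyS : y ∉ S := fun h => by rw [Finset.insert_eq_of_mem h] at hyk; omega
    have h₁ : Linked (fun u v => (u, v) ∈ F) A ↑(insert x S) (Fin (insert x S).card) := by
      rw [hxk]
      -- A set separating `A` from `S ∪ {x}` without the edge separates `A` from `C` with it: up to
      -- its first vertex in `S ∪ {x}` a route cannot have used the edge.
      refine ih _ _ _ fun T hT => hk T fun a ha c hc s hr => ?_
      obtain ⟨s', c', hr', hs', hc', hu⟩ := hr.exists_first (hSx a ha c hc s hr)
      obtain ⟨v, hv, hvT⟩ := hT a ha c' hc' s' (hr'.of_notMem_tail hRF fun h => hu x h (by simp))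
      exact ⟨v, hs' hv, hvT⟩
    have h₂ : Linked (fun u v => (u, v) ∈ F) ↑(insert y S) C (Fin (insert y S).card) := by
      rw [hyk]
      refine ih _ _ _ fun T hT => hk T fun a ha c hc s hr => ?_
      obtain ⟨s', c', hr', hs', hc', hu⟩ := hr.exists_last (hSy a ha c hc s hr)
      obtain ⟨v, hv, hvT⟩ := hT c' hc' c hc s' (hr'.of_notMem_head hRF fun h => hu y h (by simp))
      exact ⟨v, hs' hv, hvT⟩
    obtain ⟨P, hP, hPd⟩ := h₁.exists_paths_to
    obtain ⟨Q, hQ, hQd⟩ := h₂.exists_paths_from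
    -- If the two linkages meet in `z`, following one to `z` and the other from there gives a route
    -- from `A` to `C` without the edge. It must meet `S`, and by truncation it can do so only at
    -- `z`.
    have hPQ : ∀ s ∈ insert x S, ∀ t ∈ insert y S, ∀ z ∈ P s, z ∈ Q t → z ∈ S := by
      intro s hs t ht z hzs hzt
      obtain ⟨⟨a, ha, hra⟩, hus⟩ := hP s hs
      obtain ⟨⟨c, hc, hrc⟩, hut⟩ := hQ t ht
      obtain ⟨s₁, s₂, h1, h2, h3, h4, h5⟩ := hra.split hzs
      obtain ⟨t₁, t₂, k1, k2, k3, k4, k5⟩ := hrc.split hzt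
      obtain ⟨w, hw, hrw⟩ := h1.exists_subset_trans k2
      obtain ⟨v, hv, hvS⟩ := hS a ha c hc w hrw
      rcases hw hv with hv | hv
      · obtain rfl := hus v (h3 hv) (Finset.mem_insert_of_mem hvS)
        rwa [← h5 v hv h2.right_mem]
      · obtain rfl := hut v (k4 hv) (Finset.mem_insert_of_mem hvS)
        rwa [← k5 v k1.left_mem hv]
    have hPQ' : ∀ s ∈ insert x S, ∀ t ∈ insert y S, ∀ z ∈ P s, z ∈ Q t → z = s ∧ z = t := by
      intro s hs t ht z hzs hzt
      have hz := hPQ s hs t ht z hzs hzt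
      exact ⟨(hP s hs).2 z hzs (Finset.mem_insert_of_mem hz),
        (hQ t ht).2 z hzt (Finset.mem_insert_of_mem hz)⟩
    -- The path ending at `x` continues through the edge at `y`; every other one continues at its
    -- own end.
    let g : V → V := fun s => if s = x then y else s
    have hgT : ∀ s ∈ insert x S, g s ∈ insert y S := by
      intro s hs
      by_cases hsx : s = x
      · simp [g, hsx]
      · simpa [g, hsx] using Or.inr ((Finset.mem_insert.1 hs).resolve_left hsx)
    have hginj : ∀ s ∈ insert x S, ∀ t ∈ insert x S, g s = g t → s = t := by
      intro s hs t ht h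
      by_cases hsx : s = x <;> by_cases htx : t = x
      · rw [hsx, htx]
      · simp only [g, hsx, htx, if_true, if_false] at h
        exact absurd (h ▸ (Finset.mem_insert.1 ht).resolve_left htx) hyS
      · simp only [g, hsx, htx, if_true, if_false] at h
        exact absurd (h ▸ (Finset.mem_insert.1 hs).resolve_left hsx) hyS
      · simpa [g, hsx, htx] using h
    have hL : Linked (fun u v => (u, v) ∈ insert (x, y) F) A C ↥(insert x S) := by
      refine ⟨fun s => P s ∪ Q (g s), fun s => ?_, fun s t hst => ?_⟩
      · obtain ⟨s, hs⟩ := s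
        obtain ⟨⟨a, ha, hra⟩, hus⟩ := hP s hs
        obtain ⟨⟨c, hc, hrc⟩, hut⟩ := hQ (g s) (hgT s hs)
        refine ⟨a, ha, c, hc, ?_⟩
        change Route _ a (P s ∪ Q (g s)) c
        by_cases hsx : s = x
        · subst hsx
          have hgs : g s = y := if_pos rfl
          rw [hgs] at hrc ⊢
          have hd : ∀ z ∈ P s, z ∉ Q y := fun z hz hz' =>
            hxS ((hPQ' s hs y (by simp) z hz hz').1 ▸ hPQ s hs y (by simp) z hz hz')
          have := ((hra.mono hFR).snoc (Finset.mem_insert_self _ _)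
            fun h => hd y h hrc.left_mem).trans (hrc.mono hFR) (by
              rintro v (rfl | hv) hv'
              · rfl
              · exact absurd hv' (hd v hv))
          rwa [Set.insert_union, ← Set.union_insert, Set.insert_eq_of_mem hrc.left_mem] at this
        · have hgs : g s = s := if_neg hsx
          have := hgT s hs
          rw [hgs] at hrc this ⊢
          exact (hra.mono hFR).trans (hrc.mono hFR) fun v hv hv' => (hPQ' s hs s this v hv hv').1
      · obtain ⟨s, hs⟩ := s
        obtain ⟨t, ht⟩ := t
        have hst' : s ≠ t := fun h => hst (Subtype.ext h)
        have key : ∀ s ∈ insert x S, ∀ t ∈ insert x S, s ≠ t → Disjoint (P s) (Q (g t)) := by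
          intro s hs t ht hst
          refine Set.disjoint_left.2 fun z hz hz' => hst ?_
          have hzS := hPQ s hs _ (hgT t ht) z hz hz'
          obtain ⟨h1, h2⟩ := hPQ' s hs _ (hgT t ht) z hz hz'
          have hgs : g s = s := if_neg fun h : s = x => hxS (h ▸ h1 ▸ hzS)
          exact hginj s hs t ht (hgs.trans (h1.symm.trans h2))
        simp only [Set.disjoint_union_left, Set.disjoint_union_right]
        exact ⟨⟨hPd s hs t ht hst', (key t ht s hs hst'.symm).symm⟩, key s hs t ht hst',
          hQd _ (hgT s hs) _ (hgT t ht) fun h => hst' (hginj s hs t ht h)⟩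
    exact hL.comp ((insert x S).equivFinOfCardEq hxk).symm.injective

/-- Menger's theorem for directed paths between two sets of vertices. -/
theorem exists_separates_and_linked {V : Type*} [Finite V] (R : V → V → Prop) (A C : Set V) :
    ∃ S : Finset V, Separates R A C S ∧ Linked R A C S := by
  classical
  cases nonempty_fintype V
  let F : Finset (V × V) := Finset.univ.filter fun e => R e.1 e.2
  have hF : (fun u v => (u, v) ∈ F) = R := by
    ext u v
    simp [F]
  have hne : ∃ n, ∃ S : Finset V, Separates R A C S ∧ S.card = n :=
    ⟨_, Finset.univ, fun a _ c _ s hr => ⟨a, hr.left_mem, by simp⟩, rfl⟩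
  obtain ⟨S, hS, hcard⟩ := Nat.find_spec hne
  refine ⟨S, hS, ?_⟩
  have h := linked_of_forall_separates F A C S.card fun T hT => by
    rw [hcard]
    exact Nat.find_min' hne ⟨T, hF ▸ hT, rfl⟩
  rw [hF] at h
  exact h.comp S.equivFin.injective

/-! ### Bidirected walks and the split graph -/

namespace BidirectedGraph

variable {V E : Type*} {B : BidirectedGraph V E}

namespace OrientedEdge

/-- The same edge with tail and head interchanged. -/
def reverse (f : B.OrientedEdge) : B.OrientedEdge :=
  ⟨f.edge, f.head, f.tail, f.ends_eq.trans Sym2.eq_swap⟩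

theorem tail_ne_head (f : B.OrientedEdge) : f.tail ≠ f.head := by
  intro h
  apply B.loopless f.edge
  rw [f.ends_eq, h]
  exact Sym2.mk_isDiag_iff.2 rfl

theorem tailSign_eq_headSign {f g : B.OrientedEdge} (he : f.edge = g.edge)
    (h : f.tail = g.head) : f.tailSign = g.headSign :=
  congrArg B.sign (Subtype.ext (Prod.ext he h))

end OrientedEdge

theorem isWalk_append {u v : V} {S T : List B.OrientedEdge} :
    B.IsWalk u (S ++ T) v ↔ ∃ w, B.IsWalk u S w ∧ B.IsWalk w T v := by
  induction S generalizing u with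
  | nil => simp [IsWalk]
  | cons f S ih => simp [IsWalk, ih, and_assoc]

theorem isWalk_concat {u v : V} {T : List B.OrientedEdge} {f : B.OrientedEdge} :
    B.IsWalk u (T ++ [f]) v ↔ B.IsWalk u T f.tail ∧ f.head = v := by
  rw [isWalk_append]
  constructor
  · rintro ⟨w, hw, h, h'⟩
    exact ⟨h ▸ hw, h'⟩
  · rintro ⟨h, h'⟩
    exact ⟨_, h, rfl, h'⟩

theorem isWalk_map_range (f : ℕ → B.OrientedEdge) (x : ℕ → V) (n : ℕ)
    (ht : ∀ k < n, (f k).tail = x k) (hh : ∀ k < n, (f k).head = x (k + 1)) :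
    B.IsWalk (x 0) ((List.range n).map f) (x n) := by
  induction n with
  | zero => rfl
  | succ n ih =>
    rw [List.range_succ, List.map_append, List.map_singleton, isWalk_concat, ht n n.lt_succ_self]
    exact ⟨ih (fun k hk => ht k (hk.trans n.lt_succ_self)) fun k hk =>
      hh k (hk.trans n.lt_succ_self), hh n n.lt_succ_self⟩

theorem tail_mem_vertices {u v : V} {T : List B.OrientedEdge} (h : B.IsWalk u T v) :
    ∀ f ∈ T, f.tail ∈ B.vertices u T := by
  induction T generalizing u with
  | nil => simp
  | cons f T ih =>
    rintro g (_ | ⟨_, hg⟩)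
    · rw [h.1]
      exact List.mem_cons_self
    · exact List.mem_cons_of_mem _ (ih h.2 g hg)

theorem head_mem_vertices (u : V) {T : List B.OrientedEdge} {f : B.OrientedEdge} (hf : f ∈ T) :
    f.head ∈ B.vertices u T :=
  List.mem_cons_of_mem _ (List.mem_map_of_mem hf)

theorem vertices_concat (u : V) (T : List B.OrientedEdge) (f : B.OrientedEdge) :
    B.vertices u (T ++ [f]) = B.vertices u T ++ [f.head] := by
  simp [vertices]

theorem edges_nodup_of_vertices_nodup {u v : V} {T : List B.OrientedEdge} (h : B.IsWalk u T v)
    (hn : (B.vertices u T).Nodup) : (T.map OrientedEdge.edge).Nodup := by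
  induction T using List.reverseRecOn generalizing v with
  | nil => simp
  | append_singleton T f ih =>
    rw [vertices_concat, List.nodup_append] at hn
    rw [isWalk_concat] at h
    rw [List.map_append, List.nodup_append]
    refine ⟨ih h.1 hn.1, by simp, ?_⟩
    simp only [List.mem_map, List.map_cons, List.map_nil, List.mem_singleton]
    rintro _ ⟨g, hg, rfl⟩ _ rfl he
    have hf : f.head ∈ B.ends g.edge := by
      rw [he, f.ends_eq]
      exact Sym2.mem_mk_right _ _
    rw [g.ends_eq, Sym2.mem_iff] at hf
    rcases hf with hf | hf
    · exact hn.2.2 _ (tail_mem_vertices h.1 g hg) _ (by simp) hf.symm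
    · exact hn.2.2 _ (head_mem_vertices u hg) _ (by simp) hf.symm

theorem isPath_iff {u v : V} {T : List B.OrientedEdge} :
    B.IsPath u T v ↔ B.IsWalk u T v ∧ T.IsChain (fun f g => g.tailSign = -f.headSign) ∧
      (B.vertices u T).Nodup :=
  ⟨fun h => ⟨h.isTrail.isWalk, h.isTrail.switch, h.vertices_nodup⟩,
    fun h => ⟨⟨h.1, edges_nodup_of_vertices_nodup h.1 h.2.2, h.2.1⟩, h.2.2⟩⟩

/-- The other half of a split vertex. -/
def flip (p : V × ℤˣ) : V × ℤˣ := (p.1, -p.2)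

@[simp] theorem flip_flip (p : V × ℤˣ) : flip (flip p) = p := by simp [flip]

@[simp] theorem flip_fst (p : V × ℤˣ) : (flip p).1 = p.1 := rfl

@[simp] theorem flip_snd (p : V × ℤˣ) : (flip p).2 = -p.2 := rfl

theorem flip_ne (p : V × ℤˣ) : flip p ≠ p := fun h =>
  units_ne_neg_self p.2 (congrArg Prod.snd h).symm

theorem eq_or_eq_flip {p q : V × ℤˣ} (h : p.1 = q.1) : p = q ∨ p = flip q := by
  rcases eq_or_ne p.2 q.2 with h' | h'
  · exact Or.inl (Prod.ext h h')
  · refine Or.inr (Prod.ext h ?_)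
    rcases Int.units_eq_one_or p.2 with h1 | h1 <;> rcases Int.units_eq_one_or q.2 with h2 | h2 <;>
      simp_all

variable (B) in
/-- The graph obtained by splitting every vertex `v` into the two halves `(v, 1)` and `(v, -1)`
according to the signs of the half-edges. The halves of `v ≠ r` are joined by an edge, while both
halves of `r` receive all the edges at `r`. -/
def splitGraph (r : V) : SimpleGraph (V × ℤˣ) where
  Adj p q := (p.1 = q.1 ∧ p.1 ≠ r ∧ p.2 = -q.2) ∨ ∃ f : B.OrientedEdge, f.tail = p.1 ∧
    f.head = q.1 ∧ (p.1 = r ∨ f.tailSign = p.2) ∧ (q.1 = r ∨ f.headSign = q.2)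
  symm := ⟨by
    rintro p q (⟨h1, h2, h3⟩ | ⟨f, h1, h2, h3, h4⟩)
    · exact Or.inl ⟨h1.symm, h1 ▸ h2, by simp [h3]⟩
    · exact Or.inr ⟨f.reverse, h2, h1, h4, h3⟩⟩
  loopless := ⟨by
    rintro p (⟨-, -, h⟩ | ⟨f, h1, h2, -⟩)
    · exact units_ne_neg_self _ h
    · exact f.tail_ne_head (h1.trans h2.symm)⟩

theorem splitGraph_adj_flip {r : V} {p : V × ℤˣ} (hp : p.1 ≠ r) :
    (B.splitGraph r).Adj p (flip p) :=
  Or.inl ⟨rfl, hp, by simp⟩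

end BidirectedGraph

/-! ### Perfect matchings of the split graph and cleanness -/

/-- Two involutions without fixed points: neither exchanges points of an orbit of their product. -/
theorem Function.Involutive.ne_iterate_comp {α : Type*} {φ μ : α → α} (hφ : φ.Involutive)
    (hμ : μ.Involutive) (hφ' : ∀ x, φ x ≠ x) (hμ' : ∀ x, μ x ≠ x) :
    ∀ (m : ℕ) (x : α), φ x ≠ (μ ∘ φ)^[m] x
  | 0, x => hφ' x
  | 1, x => fun h => hμ' (φ x) h.symm
  | m + 2, x => by
    intro h
    rw [Function.iterate_succ_apply', Function.iterate_succ_apply] at h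
    -- Cancelling `μ ∘ φ` gives the same equation at `μ (φ x)` with `m` in place of `m + 2`; the two
    -- base cases are fixed points of `φ` and `μ`.
    have h' := congrArg (φ ∘ μ) h
    simp only [Function.comp_apply, hμ _, hφ _] at h'
    exact hφ.ne_iterate_comp hμ hφ' hμ' m (μ (φ x)) h'

namespace BidirectedGraph

variable {V E : Type*} {B : BidirectedGraph V E}

/-- Alternately swapping halves and following the matching, the orbit of `(r, -1)` never contains
both halves of a vertex. Read once around, it is a closed trail at `r` with no other repetition: a
forbidden almost path. -/
theorem IsClean.no_isPerfectMatching [Finite V] {r : V} (h : B.IsClean r)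
    (M : (B.splitGraph r).Subgraph) : ¬ M.IsPerfectMatching := by
  intro hM
  choose μ hμM hμu using fun p => hM.1 (hM.2 p)
  have hμ : Function.Involutive μ := fun p => (hμu (μ p) p (hμM p).symm).symm
  have hμadj : ∀ p, (B.splitGraph r).Adj p (μ p) := fun p => (hμM p).adj_sub
  have hφ : Function.Involutive (flip : V × ℤˣ → V × ℤˣ) := flip_flip
  set ρ : V × ℤˣ → V × ℤˣ := μ ∘ flip with hρ
  have hρinj : Function.Injective ρ := hμ.injective.comp hφ.injective
  let x : ℕ → V × ℤˣ := fun k => ρ^[k] (r, -1)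
  have hx0 : (x 0).1 = r := rfl
  have hxs : ∀ k, x (k + 1) = μ (flip (x k)) := fun k => Function.iterate_succ_apply' ρ k _
  have hflip : ∀ j m, flip (x j) ≠ x (j + m) := by
    intro j m h
    refine hφ.ne_iterate_comp hμ flip_ne (fun p hp => ?_) m (x j) ?_
    · exact (hμadj p).ne hp.symm
    · rw [h, add_comm]
      exact Function.iterate_add_apply ρ m j _
  have hflip' : ∀ j k, flip (x j) ≠ x k := by
    intro j k h
    rcases le_total j k with hjk | hjk
    · obtain ⟨m, rfl⟩ := Nat.exists_eq_add_of_le hjk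
      exact hflip _ _ h
    · obtain ⟨m, rfl⟩ := Nat.exists_eq_add_of_le hjk
      exact hflip k m (by rw [← h, flip_flip])
  have hfst : ∀ j k, (x j).1 = (x k).1 → x j = x k := fun j k hjk =>
    (eq_or_eq_flip hjk).resolve_right fun h => hflip' k j h.symm
  have hroot : ∀ k, (x k).1 = r → x k = x 0 := fun k hk => hfst k 0 hk
  -- A matching edge joining the two halves of one vertex would be a fixed point of `ρ`, so the
  -- orbit would be constantly at the root, where the halves are not joined.
  have hfix : ∀ k, x (k + 1) = x k → x k = x 0 := by
    intro k hk
    have h1 : ρ (r, -1) = (r, -1) := by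
      apply hρinj.iterate k
      rw [← Function.iterate_succ_apply]
      exact hk
    exact Function.iterate_fixed h1 k
  have hedge : ∀ k, ∃ f : B.OrientedEdge, f.tail = (x k).1 ∧ f.head = (x (k + 1)).1 ∧
      ((x k).1 = r ∨ f.tailSign = -(x k).2) ∧
        ((x (k + 1)).1 = r ∨ f.headSign = (x (k + 1)).2) := by
    intro k
    have h := hμadj (flip (x k))
    rw [← hxs] at h
    refine h.resolve_left ?_
    rintro ⟨h1, h2, h3⟩
    rw [flip_fst] at h1 h2
    rw [flip_snd, neg_inj] at h3
    exact h2 (congrArg Prod.fst (hfix k (Prod.ext h1.symm h3.symm)))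
  choose f hft hfh hfts hfhs using hedge
  have hper : (r, -1) ∈ Function.periodicPts ρ := hρinj.mem_periodicPts _
  have hn := Function.minimalPeriod_pos_of_mem_periodicPts hper
  obtain ⟨m, hm⟩ := Nat.exists_eq_succ_of_ne_zero hn.ne'
  have hxn : x (m + 1) = x 0 := by
    rw [← Nat.succ_eq_add_one, ← hm]
    exact Function.iterate_minimalPeriod
  have hinj : ∀ i < m + 1, ∀ j < m + 1, (x i).1 = (x j).1 → i = j := by
    intro i hi j hj hij
    refine Function.iterate_injOn_Iio_minimalPeriod (f := ρ) (x := (r, -1)) ?_ ?_ (hfst i j hij)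
    · simpa [hm] using hi
    · simpa [hm] using hj
  have hne : ∀ k, (x k).1 ≠ (x (k + 1)).1 := fun k hk =>
    (f k).tail_ne_head (by rw [hft, hfh, hk])
  have hsucc : ∀ k, k + 1 < m + 1 → (x (k + 1)).1 ≠ r := fun k hk h =>
    absurd (hinj _ hk 0 (by omega) (h.trans hx0.symm)) (by omega)
  have hwalk : ∀ k, B.IsWalk r ((List.range k).map f) (x k).1 := fun k =>
    isWalk_map_range f (fun k => (x k).1) k (fun _ _ => hft _) fun _ _ => hfh _
  have hswitch : ∀ k ≤ m + 1,
      ((List.range k).map f).IsChain (fun f g => g.tailSign = -f.headSign) := by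
    intro k hk
    rw [List.isChain_iff_getElem]
    intro i hi
    simp only [List.length_map, List.length_range] at hi
    simp only [List.getElem_map, List.getElem_range]
    have h := hsucc i (by omega)
    rw [(hfts (i + 1)).resolve_left h, (hfhs i).resolve_left h]
  have hnodup : (((List.range (m + 1)).map f).map OrientedEdge.edge).Nodup := by
    rw [List.map_map]
    refine List.Nodup.map_on ?_ List.nodup_range
    intro i hi j hj hij
    rw [List.mem_range] at hi hj
    simp only [Function.comp_apply] at hij
    have hends := (f i).ends_eq
    rw [hij, (f j).ends_eq, hft, hft, hfh, hfh, Sym2.eq_iff] at hends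
    rcases hends with ⟨h1, -⟩ | ⟨h1, h2⟩
    · exact (hinj _ hj _ hi h1).symm
    -- The edge would be traversed in both directions. At an endpoint other than the root, its sign
    -- would equal both the arrival sign and its negative.
    exfalso
    by_cases hr : (x j).1 = r
    · have hr' : (x i).1 ≠ r := fun h => hne j (by rw [hr, h2, h])
      have h3 := OrientedEdge.tailSign_eq_headSign hij (by rw [hft, hfh, h2])
      rw [(hfts i).resolve_left hr', (hfhs j).resolve_left (h2 ▸ hr'), hfst _ _ h2] at h3
      exact units_ne_neg_self _ h3.symm
    · have h3 := OrientedEdge.tailSign_eq_headSign hij.symm (by rw [hft, hfh, h1])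
      rw [(hfts j).resolve_left hr, (hfhs i).resolve_left (h1 ▸ hr), hfst _ _ h1] at h3
      exact units_ne_neg_self _ h3.symm
  refine h ⟨(List.range (m + 1)).map f, by simp, ⟨?_, hnodup, hswitch _ le_rfl⟩, Or.inr
    ⟨(x m).1, ?_⟩⟩
  · have := hwalk (m + 1)
    rwa [hxn] at this
  · rw [List.range_succ, List.map_append, List.map_singleton, List.dropLast_concat, isPath_iff]
    refine ⟨hwalk m, hswitch m (by omega), ?_⟩
    have : B.vertices r ((List.range m).map f) = (List.range (m + 1)).map fun k => (x k).1 := by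
      rw [List.range_succ_eq_map]
      simp [vertices, List.map_map, Function.comp_def, hfh, hx0]
    rw [this]
    exact List.Nodup.map_on (fun i hi j hj => hinj i (List.mem_range.1 hi) j (List.mem_range.1 hj))
      List.nodup_range

end BidirectedGraph

/-! ### The barrier given by Tutte's theorem -/

theorem Set.even_ncard_of_involution {α : Type*} [Finite α] {s : Set α} {f : α → α}
    (hf : f.Involutive) (hne : ∀ x, f x ≠ x) (hs : ∀ x ∈ s, f x ∈ s) : Even s.ncard := by
  classical
  cases nonempty_fintype α
  rw [Set.ncard_eq_toFinset_card', ← ZMod.natCast_eq_zero_iff_even]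
  have : ∑ _x ∈ s.toFinset, (1 : ZMod 2) = 0 :=
    Finset.sum_involution (fun x _ => f x) (fun _ _ => by decide) (fun x _ _ => hne x)
      (fun x hx => by simpa using hs x (by simpa using hx)) fun x _ => hf x
  simpa using this

namespace BidirectedGraph

variable {V E : Type*} {B : BidirectedGraph V E}

variable (B) in
/-- A barrier of the split graph, with `κ` naming the components left after deleting `U`: the
halves of the root and the other halves of the elements of `U` lie in distinct components. -/
structure IsBarrier {C : Type*} (r : V) (U : Set (V × ℤˣ)) (κ : V × ℤˣ → C) : Prop where
  root_notMem : ∀ s, (r, s) ∉ U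
  eq_of_adj : ∀ p ∉ U, ∀ q ∉ U, (B.splitGraph r).Adj p q → κ p = κ q
  flip_notMem : ∀ u ∈ U, flip u ∉ U
  injOn : ∀ u ∈ U, ∀ u' ∈ U, κ (flip u) = κ (flip u') → u = u'
  root_ne : κ (r, 1) ≠ κ (r, -1)
  ne_root : ∀ u ∈ U, ∀ s, κ (flip u) ≠ κ (r, s)

-- Counting odd components in two ways gives exactly `|U| + 2`, and tightness of the count yields
-- all the separation properties.
open SimpleGraph in
theorem IsClean.exists_isBarrier.{u, v} {V : Type u} {E : Type v} {B : BidirectedGraph V E}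
    [Finite V] {r : V} (h : B.IsClean r) :
    ∃ (C : Type u) (U : Set (V × ℤˣ)) (κ : V × ℤˣ → C), B.IsBarrier r U κ := by
  classical
  cases nonempty_fintype V
  have hT : ¬ ∀ U, ¬ (B.splitGraph r).IsTutteViolator U := fun hT => by
    obtain ⟨M, hM⟩ := SimpleGraph.tutte.2 hT
    exact h.no_isPerfectMatching M hM
  push Not at hT
  obtain ⟨U, hU⟩ := hT
  set D := (⊤ : (B.splitGraph r).Subgraph).deleteVerts U with hD
  have hverts : ∀ p, p ∈ D.verts ↔ p ∉ U := by simp [hD]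
  -- The split graph has an even number of vertices, so the number of odd components has the parity
  -- of `|U|`; exceeding it means exceeding it by two.
  have hcount : U.ncard + 2 ≤ D.coe.oddComponents.ncard := by
    have h1 : U.ncard < D.coe.oddComponents.ncard := hU
    have h2 := D.coe.odd_ncard_oddComponents
    have h3 : Nat.card D.verts + U.ncard = 2 * Fintype.card V := by
      have : D.verts = Uᶜ := by ext p; simp [hverts]
      rw [this, Nat.card_coe_set_eq, add_comm, Set.ncard_add_ncard_compl, Nat.card_prod]
      simp [mul_comm]
    by_contra hlt
    have h4 : D.coe.oddComponents.ncard = U.ncard + 1 := by omega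
    rw [h4] at h2
    have h5 : Even (Nat.card D.verts + U.ncard) := by rw [h3]; exact even_two_mul _
    rw [Nat.even_add'] at h5
    rw [Nat.odd_add_one] at h2
    tauto
  let κ : V × ℤˣ → Option D.coe.ConnectedComponent := fun p =>
    if hp : p ∈ D.verts then some (D.coe.connectedComponentMk ⟨p, hp⟩) else none
  have hadj : ∀ p ∉ U, ∀ q ∉ U, (B.splitGraph r).Adj p q → κ p = κ q := by
    intro p hp q hq hpq
    have hp' := (hverts p).2 hp
    have hq' := (hverts q).2 hq
    simp only [κ, hp', hq', dif_pos, Option.some_inj]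
    refine ConnectedComponent.sound (Adj.reachable ?_)
    simp [hD, hp, hq, hpq]
  have hκ : ∀ (c : D.coe.ConnectedComponent) (p), κ p = some c ↔
      p ∈ (Subtype.val '' c.supp : Set (V × ℤˣ)) := by
    intro c p
    by_cases hp : p ∈ D.verts
    · simp [κ, hp, ConnectedComponent.mem_supp_iff]
    · simp [κ, hp]
  -- Otherwise swapping halves would be a fixed-point-free involution of the component, making it
  -- even.
  have hexists : ∀ c ∈ D.coe.oddComponents, ∃ p, κ p = some c ∧ p ∉ U ∧
      (p.1 = r ∨ flip p ∈ U) := by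
    intro c hc
    by_contra! hno
    have hc' : Odd c.supp.ncard := hc
    rw [← Set.ncard_image_of_injective _ Subtype.val_injective, ← Nat.not_even_iff_odd] at hc'
    refine hc' (Set.even_ncard_of_involution (f := flip) flip_flip flip_ne fun p hp => ?_)
    have hpU : p ∉ U := by
      obtain ⟨p, -, rfl⟩ := hp
      exact (hverts _).1 p.2
    obtain ⟨h1, h2⟩ := hno p ((hκ c p).2 hp) hpU
    rw [← hκ, ← hadj p hpU _ h2 (splitGraph_adj_flip h1)]
    exact (hκ c p).2 hp
  have : Nonempty (V × ℤˣ) := ⟨(r, 1)⟩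
  choose! p hpκ hpU hpr using hexists
  -- An odd component is charged to its half of the root or to the element of `U` whose partner it
  -- contains. The charge determines the chosen half `p c`, hence the component.
  let τ : D.coe.ConnectedComponent → V × ℤˣ := fun c => if (p c).1 = r then p c else flip (p c)
  have hpτ : ∀ c, p c = if (τ c).1 = r then τ c else flip (τ c) := by
    intro c
    by_cases hr : (p c).1 = r <;> simp [τ, hr]
  have hτinj : Set.InjOn τ D.coe.oddComponents := by
    intro c hc d hd hcd
    have : p c = p d := by rw [hpτ, hpτ d, hcd]
    have h' := hpκ c hc
    rw [this, hpκ d hd, Option.some_inj] at h'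
    exact h'.symm
  have himage : τ '' D.coe.oddComponents = U ∪ {(r, 1), (r, -1)} := by
    refine Set.eq_of_subset_of_ncard_le ?_ ?_
    · rintro _ ⟨c, hc, rfl⟩
      by_cases hr : (p c).1 = r
      · right
        rcases Int.units_eq_one_or (p c).2 with h | h
        · left; simp [τ, hr, Prod.ext_iff, h]
        · right; simp [τ, hr, Prod.ext_iff, h]
      · left
        simpa [τ, hr] using (hpr c hc).resolve_left hr
    · rw [hτinj.ncard_image]
      refine ((Set.ncard_union_le _ _).trans ?_).trans hcount
      gcongr
      exact (Set.ncard_insert_le _ _).trans (by simp)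
  have hkey : ∀ t ∈ U ∪ {(r, 1), (r, -1)}, ∃ c ∈ D.coe.oddComponents, τ c = t := by
    rw [← himage]
    exact fun t ht => ht
  have hmem : ∀ s, (r, s) ∈ U ∪ {(r, 1), (r, -1)} := by
    intro s
    rcases Int.units_eq_one_or s with rfl | rfl <;> simp
  have hrU : ∀ s, (r, s) ∉ U := by
    intro s
    obtain ⟨c, hc, hcs⟩ := hkey _ (hmem s)
    have := hpτ c
    rw [hcs, if_pos rfl] at this
    exact this ▸ hpU c hc
  have hUr : ∀ u ∈ U, u.1 ≠ r := fun u hu h => hrU u.2 (h ▸ hu)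
  have hdist : ∀ t ∈ U ∪ {(r, 1), (r, -1)}, ∀ t' ∈ U ∪ {(r, 1), (r, -1)},
      κ (if t.1 = r then t else flip t) = κ (if t'.1 = r then t' else flip t') → t = t' := by
    intro t ht t' ht' htt
    obtain ⟨c, hc, rfl⟩ := hkey t ht
    obtain ⟨c', hc', rfl⟩ := hkey t' ht'
    rw [← hpτ, ← hpτ, hpκ c hc, hpκ c' hc', Option.some_inj] at htt
    rw [htt]
  refine ⟨_, U, κ, hrU, hadj, fun u hu => ?_, fun u hu u' hu' huu => ?_, fun h => ?_,
    fun u hu s h => ?_⟩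
  · obtain ⟨c, hc, rfl⟩ := hkey u (Or.inl hu)
    have := hpτ c
    rw [if_neg (hUr _ hu)] at this
    exact this ▸ hpU c hc
  · refine hdist u (Or.inl hu) u' (Or.inl hu') ?_
    rwa [if_neg (hUr u hu), if_neg (hUr u' hu')]
  · have := hdist _ (hmem 1) _ (hmem (-1)) (by simpa using h)
    simp at this
  · have := hdist u (Or.inl hu) _ (hmem s) (by simpa [hUr u hu] using h)
    exact hUr u hu (by rw [this])

end BidirectedGraph

/-! ### Blobs, segments and the digraph on the bases -/

namespace BidirectedGraph

variable {V E : Type*} {B : BidirectedGraph V E}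

theorem vertices_append (u : V) (S T : List B.OrientedEdge) :
    B.vertices u (S ++ T) = B.vertices u S ++ T.map OrientedEdge.head := by
  simp [vertices]

theorem right_mem_vertices {u v : V} {T : List B.OrientedEdge} (h : B.IsWalk u T v) :
    v ∈ B.vertices u T := by
  induction T generalizing u with
  | nil => exact List.mem_singleton.2 (Eq.symm h)
  | cons f T ih => exact List.mem_cons_of_mem _ (ih h.2)

theorem head_eq_or_exists_tail_eq {u v : V} {T : List B.OrientedEdge} (h : B.IsWalk u T v)
    {f : B.OrientedEdge} (hf : f ∈ T) : f.head = v ∨ ∃ g ∈ T, g.tail = f.head := by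
  induction T generalizing u with
  | nil => simp at hf
  | cons g T ih =>
    rcases List.mem_cons.1 hf with rfl | hf
    · cases T with
      | nil => exact Or.inl h.2
      | cons g' T => exact Or.inr ⟨g', by simp, h.2.1⟩
    · rcases ih h.2 hf with h' | ⟨g', hg', h'⟩
      · exact Or.inl h'
      · exact Or.inr ⟨g', List.mem_cons_of_mem _ hg', h'⟩

theorem IsPath.isWalk {u v : V} {T : List B.OrientedEdge} (h : B.IsPath u T v) :
    B.IsWalk u T v :=
  h.isTrail.isWalk

theorem IsPath.exists_left {u v : V} {S T : List B.OrientedEdge} (h : B.IsPath u (S ++ T) v) :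
    ∃ w, B.IsPath u S w ∧ B.IsWalk w T v := by
  rw [isPath_iff, isWalk_append, vertices_append] at h
  obtain ⟨⟨w, hS, hT⟩, hc, hn⟩ := h
  exact ⟨w, isPath_iff.2 ⟨hS, hc.left_of_append, hn.of_append_left⟩, hT⟩

theorem IsPath.right {u v w : V} {S T : List B.OrientedEdge} (h : B.IsPath u (S ++ T) v)
    (hw : B.IsWalk u S w) : B.IsPath w T v := by
  induction S generalizing u with
  | nil =>
    obtain rfl : u = w := hw
    exact h
  | cons f S ih =>
    refine ih ?_ hw.2
    rw [isPath_iff] at h ⊢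
    exact ⟨h.1.2, h.2.1.tail, (List.nodup_cons.1 h.2.2).2⟩

theorem IsPath.of_concat {u v : V} {T : List B.OrientedEdge} {f : B.OrientedEdge}
    (h : B.IsPath u (T ++ [f]) v) :
    B.IsPath u T f.tail ∧ f.head = v ∧ v ∉ B.vertices u T := by
  obtain ⟨w, hT, rfl, rfl⟩ := h.exists_left
  refine ⟨hT, rfl, fun hmem => ?_⟩
  have := h.vertices_nodup
  rw [vertices_concat, List.nodup_append] at this
  exact this.2.2 _ hmem _ (by simp) rfl

section Barrier

variable {C : Type*} {r : V} {U : Set (V × ℤˣ)} {κ : V × ℤˣ → C}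

open Classical in
/-- The component of a half of `v` that does not belong to `U`. -/
noncomputable def blob (U : Set (V × ℤˣ)) (κ : V × ℤˣ → C) (v : V) : C :=
  if (v, 1) ∉ U then κ (v, 1) else κ (v, -1)

/-- The bases of the blobs: the root and the vertices with a half in `U`. -/
def bases (r : V) (U : Set (V × ℤˣ)) : Set V :=
  {v | v = r ∨ ∃ s, (v, s) ∈ U}

theorem IsBarrier.fst_ne (hU : B.IsBarrier r U κ) {u : V × ℤˣ} (hu : u ∈ U) : u.1 ≠ r :=
  fun h => hU.root_notMem u.2 (h ▸ hu)

/-- When both halves of a vertex other than the root avoid `U` they are adjacent, so the choice made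
in `blob` is immaterial. -/
theorem IsBarrier.blob_eq (hU : B.IsBarrier r U κ) {p : V × ℤˣ} (hp : p ∉ U) (hr : p.1 ≠ r) :
    blob U κ p.1 = κ p := by
  obtain ⟨v, s⟩ := p
  rcases Int.units_eq_one_or s with rfl | rfl
  · exact if_pos hp
  · by_cases h : (v, 1) ∈ U
    · exact if_neg (not_not.2 h)
    · exact (if_pos h).trans (hU.eq_of_adj _ h _ hp (splitGraph_adj_flip (p := (v, 1)) hr))

theorem IsBarrier.blob_base (hU : B.IsBarrier r U κ) {u : V × ℤˣ} (hu : u ∈ U) :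
    blob U κ u.1 = κ (flip u) :=
  hU.blob_eq (p := flip u) (hU.flip_notMem u hu) (hU.fst_ne (u := u) hu)

theorem IsBarrier.blob_root (hU : B.IsBarrier r U κ) : blob U κ r = κ (r, 1) :=
  if_pos (hU.root_notMem 1)

theorem IsBarrier.blob_injOn (hU : B.IsBarrier r U κ) : Set.InjOn (blob U κ) (bases r U) := by
  rintro v (rfl | ⟨s, hs⟩) w (rfl | ⟨t, ht⟩) h
  · rfl
  · rw [hU.blob_root, hU.blob_base ht] at h
    exact absurd h.symm (hU.ne_root _ ht 1)
  · rw [hU.blob_root, hU.blob_base hs] at h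
    exact absurd h (hU.ne_root _ hs 1)
  · rw [hU.blob_base hs, hU.blob_base ht] at h
    exact congrArg Prod.fst (hU.injOn _ hs _ ht h)

/-- `T` is trivial at the root, or it enters the blob with base `w` through a half in `U`. -/
def Enters (r : V) (U : Set (V × ℤˣ)) (T : List B.OrientedEdge) (w : V) : Prop :=
  (T = [] ∧ w = r) ∨ ∃ T' g, T = T' ++ [g] ∧ (w, g.headSign) ∈ U

theorem Enters.mem_bases {T : List B.OrientedEdge} {w : V} (h : Enters r U T w) :
    w ∈ bases r U := by
  rcases h with ⟨-, h⟩ | ⟨_, _, -, h⟩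
  · exact Or.inl h
  · exact Or.inr ⟨_, h⟩

/-- `w` is the base entered last. The final clause, that the half through which the path would
continue is not in `U`, keeps the induction going: an edge arriving outside `U` then joins two
halves outside `U` and stays in the component. -/
theorem IsBarrier.exists_decomposition (hU : B.IsBarrier r U κ) {T : List B.OrientedEdge} {v : V}
    (h : B.IsPath r T v) :
    ∃ T₁ T₂ w, T = T₁ ++ T₂ ∧ B.IsWalk r T₁ w ∧ Enters r U T₁ w ∧ B.IsWalk w T₂ v ∧
      (∀ y ∈ B.vertices w T₂, blob U κ y = blob U κ w) ∧ (w = r → T₂ = []) ∧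
        ∀ T' g, T = T' ++ [g] → (v, -g.headSign) ∉ U := by
  induction T using List.reverseRecOn generalizing v with
  | nil =>
    obtain rfl : r = v := h.isWalk
    exact ⟨[], [], r, rfl, rfl, Or.inl ⟨rfl, rfl⟩, rfl, by simp [vertices], fun _ => rfl, by simp⟩
  | append_singleton T f ih =>
    obtain ⟨hT, rfl, hv⟩ := h.of_concat
    obtain ⟨T₁, T₂, w, hT12, hw₁, hent, hw₂, hblob, hroot, hlast⟩ := ih hT
    have hd : (f.tail, f.tailSign) ∉ U := by
      rcases List.eq_nil_or_concat T with hnil | ⟨T', g, hg⟩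
      · subst hnil
        have : r = f.tail := hT.isWalk
        exact this ▸ hU.root_notMem _
      · rw [List.concat_eq_append] at hg
        have hc := h.isTrail.switch
        subst hg
        rw [List.append_assoc] at hc
        have := (List.isChain_append_cons_cons.1 hc).2.1
        rw [this]
        exact hlast T' g rfl
    have hvr : f.head ≠ r := fun h => hv (h ▸ List.mem_cons_self)
    by_cases ha : (f.head, f.headSign) ∈ U
    · refine ⟨T ++ [f], [], f.head, by simp, h.isWalk, Or.inr ⟨T, f, rfl, ha⟩, rfl,
        by simp [vertices], fun _ => rfl, fun T' g hg => ?_⟩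
      obtain rfl : f = g := by simpa using (List.append_inj' hg rfl).2
      exact hU.flip_notMem _ ha
    -- Both halves of the root receive this edge, so it would merge their components.
    · have hyr : f.tail ≠ r := by
        intro hyr
        have hadj : ∀ s, κ (r, s) = κ (f.head, f.headSign) := fun s =>
          hU.eq_of_adj _ (hU.root_notMem s) _ ha
            (Or.inr ⟨f, hyr, rfl, Or.inl rfl, Or.inr rfl⟩)
        exact hU.root_ne ((hadj 1).trans (hadj (-1)).symm)
      have hwr : w ≠ r := by
        intro hwr
        have h₂ := hroot hwr
        subst h₂ hwr
        exact hyr (Eq.symm hw₂)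
      have hκ : κ (f.head, f.headSign) = blob U κ w := by
        rw [← hblob _ (right_mem_vertices hw₂), hU.blob_eq (p := (f.tail, f.tailSign)) hd hyr]
        exact (hU.eq_of_adj _ hd _ ha (Or.inr ⟨f, rfl, rfl, Or.inr rfl, Or.inr rfl⟩)).symm
      refine ⟨T₁, T₂ ++ [f], w, by simp [hT12], hw₁, hent, isWalk_concat.2 ⟨hw₂, rfl⟩, ?_,
        fun h => absurd h hwr, fun T' g hg hfg => ?_⟩
      · intro y hy
        rw [vertices_concat, List.mem_append, List.mem_singleton] at hy
        rcases hy with hy | rfl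
        · exact hblob y hy
        · rw [hU.blob_eq (p := (f.head, f.headSign)) ha hvr, hκ]
      -- Otherwise `f.head` would be a base in the blob of `w`, hence `w` itself, which the path has
      -- already visited.
      · obtain rfl : f = g := by simpa using (List.append_inj' hg rfl).2
        rcases hent with ⟨-, h⟩ | ⟨T', g, rfl, hg⟩
        · exact hwr h
        have h1 := hU.blob_base hfg
        have h2 : flip (f.head, -f.headSign) = (f.head, f.headSign) := by simp [flip]
        rw [h2, hκ] at h1
        have h3 : f.head = w := hU.blob_injOn (Or.inr ⟨_, hfg⟩) (Or.inr ⟨_, hg⟩) h1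
        apply hv
        rw [h3, hT12, vertices_append]
        exact List.mem_append_left _ (right_mem_vertices hw₁)

variable (B) in
/-- A path from the base `w` to the base `w'` that stays in the blob of `w` except for its last
vertex, leaves `w` properly and enters the blob of `w'` through a half in `U`. -/
structure IsSegment (r : V) (U : Set (V × ℤˣ)) (κ : V × ℤˣ → C) (w : V)
    (T : List B.OrientedEdge) (w' : V) : Prop where
  isPath : B.IsPath w T w'
  left_mem : w ∈ bases r U
  blob_tail : ∀ f ∈ T, blob U κ f.tail = blob U κ w ∧ (w = r → f.tail = r)
  first : w = r ∨ ∀ f ∈ T.head?, (w, -f.tailSign) ∈ U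
  last : ∃ T' g, T = T' ++ [g] ∧ (w', g.headSign) ∈ U

theorem IsBarrier.exists_isSegment (hU : B.IsBarrier r U κ) {T : List B.OrientedEdge}
    {f : B.OrientedEdge} {v : V} (h : B.IsPath r (T ++ [f]) v) (hv : (v, f.headSign) ∈ U) :
    ∃ w L, B.IsSegment r U κ w L v ∧ blob U κ f.tail = blob U κ w ∧ (w = r → f.tail = r) := by
  obtain ⟨hT, rfl, -⟩ := h.of_concat
  obtain ⟨T₁, T₂, w, rfl, hw₁, hent, hw₂, hblob, hroot, -⟩ := hU.exists_decomposition hT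
  have htail : blob U κ f.tail = blob U κ w ∧ (w = r → f.tail = r) := by
    refine ⟨hblob _ (right_mem_vertices hw₂), fun hwr => ?_⟩
    have h₂ := hroot hwr
    subst h₂ hwr
    exact Eq.symm hw₂
  rw [List.append_assoc] at h
  refine ⟨w, T₂ ++ [f], ⟨h.right hw₁, hent.mem_bases, ?_, ?_, T₂, f, rfl, hv⟩, htail⟩
  · intro g hg
    rcases List.mem_append.1 hg with hg | hg
    · refine ⟨hblob _ (tail_mem_vertices hw₂ g hg), fun hwr => ?_⟩
      simp [hroot hwr] at hg
    · obtain rfl := List.mem_singleton.1 hg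
      exact htail
  · rcases hent with ⟨-, h⟩ | ⟨T', g, rfl, hg⟩
    · exact Or.inl h
    · right
      intro e he
      have := (List.isChain_append.1 h.isTrail.switch).2.2 g (by simp) e he
      rwa [this, neg_neg]

/-- The decomposition of the path cannot end with entering a base, so its last edge lies inside a
blob. -/
theorem IsBarrier.blob_eq_of_notMem (hU : B.IsBarrier r U κ) {T : List B.OrientedEdge}
    {f : B.OrientedEdge} {v : V} (h : B.IsPath r (T ++ [f]) v) (hv : (v, f.headSign) ∉ U) :
    v ∉ bases r U ∧ blob U κ v = blob U κ f.tail := by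
  obtain ⟨hT, rfl, hvT⟩ := h.of_concat
  obtain ⟨T₁, T₂, w, hT12, hw₁, hent, hw₂, hblob, hroot, hlast⟩ := hU.exists_decomposition h
  have hne := hlast T f rfl
  constructor
  · rintro (hr | ⟨s, hs⟩)
    · exact hvT (hr ▸ List.mem_cons_self)
    · rcases eq_or_eq_flip (p := (f.head, s)) (q := (f.head, f.headSign)) rfl with h' | h'
      · exact hv (h' ▸ hs)
      · rw [h'] at hs
        exact hne hs
  · rcases List.eq_nil_or_concat T₂ with rfl | ⟨T', g, rfl⟩
    · rcases hent with ⟨rfl, -⟩ | ⟨T', g, rfl, hg⟩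
      · simp at hT12
      · rw [List.append_nil] at hT12
        obtain rfl : f = g := by simpa using (List.append_inj' hT12 rfl).2
        obtain rfl : w = f.head := hw₂
        exact absurd hg hv
    · rw [List.concat_eq_append] at hT12 hw₂ hblob
      rw [← List.append_assoc] at hT12
      obtain rfl : f = g := by simpa using (List.append_inj' hT12 rfl).2
      rw [hblob _ (right_mem_vertices hw₂), hblob _ (tail_mem_vertices hw₂ f (by simp))]

theorem IsSegment.right_mem {w w' : V} {L : List B.OrientedEdge}
    (h : B.IsSegment r U κ w L w') : w' ∈ bases r U := by
  obtain ⟨_, g, -, hg⟩ := h.last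
  exact Or.inr ⟨_, hg⟩

theorem IsSegment.right_ne (hU : B.IsBarrier r U κ) {w w' : V} {L : List B.OrientedEdge}
    (h : B.IsSegment r U κ w L w') : w' ≠ r := by
  obtain ⟨_, g, -, hg⟩ := h.last
  exact hU.fst_ne hg

variable (B) in
/-- There is a segment from `w` to `w'`. -/
def SegmentRel (r : V) (U : Set (V × ℤˣ)) (κ : V × ℤˣ → C) (w w' : V) : Prop :=
  ∃ L, B.IsSegment r U κ w L w'

theorem subset_bases_of_route {a c : V} {s : Set V} (h : Route (B.SegmentRel r U κ) a s c)
    (ha : a ∈ bases r U) : s ⊆ bases r U := by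
  induction h with
  | refl => exact Set.singleton_subset_iff.2 ha
  | snoc _ hR _ ih => exact Set.insert_subset hR.choose_spec.right_mem ih

/-- Segments are appended one at a time. The invariant that the path meets the blob of its current
end `c` only in `c` makes the next segment disjoint from it; the last clause, on the blob of `r`,
serves later disjointness of interiors. -/
theorem IsBarrier.exists_isPath_of_route (hU : B.IsBarrier r U κ) {a c : V} {s : Set V}
    (h : Route (B.SegmentRel r U κ) a s c) (ha : a = r) :
    ∃ T, B.IsPath r T c ∧ Enters r U T c ∧ ∀ v ∈ B.vertices r T,
      (∃ w ∈ s, blob U κ v = blob U κ w) ∧ (blob U κ v = blob U κ c → v = c) ∧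
        (blob U κ v = blob U κ r → v = r) := by
  induction h with
  | refl =>
    subst ha
    refine ⟨[], isPath_iff.2 ⟨rfl, by simp, by simp [vertices]⟩, Or.inl ⟨rfl, rfl⟩, ?_⟩
    simp [vertices]
  | @snoc b c s hs hR hc ih =>
    have hbase := subset_bases_of_route hs (Or.inl ha)
    obtain ⟨T, hT, hent, hinv⟩ := ih
    obtain ⟨L, hL⟩ := hR
    have hcb := hL.right_mem
    have hcs : ∀ w ∈ s, blob U κ c ≠ blob U κ w := fun w hw h =>
      hc (hU.blob_injOn hcb (hbase hw) h ▸ hw)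
    have hhead : ∀ v ∈ L.map OrientedEdge.head,
        v = c ∨ (blob U κ v = blob U κ b ∧ (b = r → v = r)) := by
      intro v hv
      obtain ⟨f, hf, rfl⟩ := List.mem_map.1 hv
      rcases head_eq_or_exists_tail_eq hL.isPath.isWalk hf with h | ⟨g, hg, h⟩
      · exact Or.inl h
      · exact Or.inr (h ▸ hL.blob_tail g hg)
    have hLn := List.nodup_cons.1 hL.isPath.vertices_nodup
    refine ⟨T ++ L, isPath_iff.2 ⟨isWalk_append.2 ⟨b, hT.isWalk, hL.isPath.isWalk⟩, ?_, ?_⟩, ?_, ?_⟩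
    · refine List.isChain_append.2 ⟨hT.isTrail.switch, hL.isPath.isTrail.switch, ?_⟩
      intro g hg e he
      rcases hent with ⟨rfl, -⟩ | ⟨T', g', rfl, hg'⟩
      · simp at hg
      obtain rfl : g' = g := by simpa using hg
      have he' := hL.first.resolve_left (hU.fst_ne hg') e he
      -- Arrival at `b` and departure from it both point to a half of `b` in `U`, and only one half
      -- can be there; hence the sign switches.
      rcases eq_or_eq_flip (p := (b, -e.tailSign)) (q := (b, g'.headSign)) rfl with h | h
      · rw [← show -e.tailSign = g'.headSign from congrArg Prod.snd h, neg_neg]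
      · rw [h] at he'
        exact absurd he' (hU.flip_notMem _ hg')
    · rw [vertices_append, List.nodup_append']
      refine ⟨hT.vertices_nodup, hLn.2, fun v hv hvL => ?_⟩
      rcases hhead v hvL with rfl | ⟨h, -⟩
      · obtain ⟨w, hw, h⟩ := (hinv v hv).1
        exact hcs w hw h
      · obtain rfl := (hinv v hv).2.1 h
        exact hLn.1 hvL
    · obtain ⟨T', g, rfl, hg⟩ := hL.last
      exact Or.inr ⟨T ++ T', g, by simp, hg⟩
    · intro v hv
      rw [vertices_append, List.mem_append] at hv
      rcases hv with hv | hv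
      · obtain ⟨⟨w, hw, h⟩, -, h3⟩ := hinv v hv
        exact ⟨⟨w, Set.mem_insert_of_mem _ hw, h⟩, fun h' => absurd (h'.symm.trans h) (hcs w hw), h3⟩
      · rcases hhead v hv with rfl | ⟨h, h'⟩
        · refine ⟨⟨v, Set.mem_insert _ _, rfl⟩, fun _ => rfl, fun h => ?_⟩
          exact hU.blob_injOn hcb (Or.inl rfl) h
        · refine ⟨⟨b, Set.mem_insert_of_mem _ hs.right_mem, h⟩, fun h'' => ?_, fun h'' => h' ?_⟩
          · exact absurd (h''.symm.trans h) (hcs b hs.right_mem)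
          · exact hU.blob_injOn (hbase hs.right_mem) (Or.inl rfl) (h.symm.trans h'')

end Barrier

end BidirectedGraph

/-! ### The two inequalities of the min-max formula -/

namespace BidirectedGraph

variable {V E : Type*} {B : BidirectedGraph V E}

theorem IsPath.mem_interior {u v y : V} {T : List B.OrientedEdge} (h : B.IsPath u T v)
    (hy : y ∈ B.interior T) : y ∈ B.vertices u T ∧ y ≠ u ∧ y ≠ v := by
  rcases List.eq_nil_or_concat T with rfl | ⟨T, f, rfl⟩
  · simp [interior] at hy
  · rw [List.concat_eq_append] at *
    obtain ⟨-, rfl, hv⟩ := h.of_concat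
    rw [interior, List.map_append, List.map_singleton, List.dropLast_concat] at hy
    have hn := (List.nodup_cons.1 h.vertices_nodup).1
    refine ⟨?_, ?_, ?_⟩
    · rw [vertices_append]
      exact List.mem_append_left _ (List.mem_cons_of_mem _ hy)
    · rintro rfl
      exact hn (by rw [List.map_append]; exact List.mem_append_left _ hy)
    · rintro rfl
      exact hv (List.mem_cons_of_mem _ hy)

theorem head_mem_interior {S T : List B.OrientedEdge} {f : B.OrientedEdge} (hT : T ≠ []) :
    f.head ∈ B.interior (S ++ f :: T) := by
  rw [interior, List.map_append, List.map_cons, List.dropLast_append_of_ne_nil (by simp),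
    List.dropLast_cons_of_ne_nil (by simpa using hT)]
  simp

theorem exists_entry {u v : V} {T : List B.OrientedEdge} (h : B.IsWalk u T v) {X : Set V}
    (hu : u ∉ X) (hv : v ∈ X) :
    ∃ T₁ f T₂, T = T₁ ++ f :: T₂ ∧ f.tail ∉ X ∧ f.head ∈ X := by
  induction T generalizing u with
  | nil =>
    obtain rfl : u = v := h
    exact absurd hv hu
  | cons f T ih =>
    by_cases hf : f.head ∈ X
    · exact ⟨[], f, T, rfl, h.1 ▸ hu, hf⟩
    · obtain ⟨T₁, g, T₂, rfl, hg⟩ := ih h.2 hf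
      exact ⟨f :: T₁, g, T₂, rfl, hg⟩

/-- The first vertex of a path in `X` is not `x`: its predecessor would lie in `N(x)`, as it is not
`r` by nonadjacency, and hence in `X`. So it is internal, and disjoint paths give distinct entry
vertices. -/
theorem IsInternallyDisjoint.encard_le {r x : V} (hrx : ∀ e : E, B.ends e ≠ s(r, x))
    {P : Set (List B.OrientedEdge)} (hP : B.IsInternallyDisjoint r x P) {X : Set V}
    (hX : {x} ∪ B.inVertices r x ⊆ X) (hr : r ∉ X) : P.encard ≤ (B.entryVertices r X).encard := by
  have hentry : ∀ T ∈ P, ∃ v ∈ B.entryVertices r X, v ∈ B.interior T := by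
    intro T hT
    have hpath := hP.1 T hT
    obtain ⟨T₁, f, T₂, rfl, hft, hfh⟩ := exists_entry hpath.isWalk hr (hX (Or.inl rfl))
    have hpre : B.IsPath r (T₁ ++ [f]) f.head := by
      rw [← List.singleton_append, ← List.append_assoc] at hpath
      obtain ⟨w, hw, -⟩ := hpath.exists_left
      rwa [hw.of_concat.2.1]
    refine ⟨f.head, ⟨hfh, f, rfl, hft, T₁, hpre⟩, head_mem_interior ?_⟩
    rintro rfl
    obtain ⟨-, rfl, -⟩ := hpath.of_concat
    refine hft (hX (Or.inr ⟨?_, f.tail_ne_head, T₁, f, hpath, rfl⟩))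
    intro h
    exact hrx f.edge (by rw [f.ends_eq, h])
  have : Nonempty V := ⟨r⟩
  choose! g hg hgi using hentry
  refine Set.encard_le_encard_of_injOn hg fun S hS T hT hST => ?_
  by_contra hne
  exact List.disjoint_left.1 (hP.2 hS hT hne) (hgi S hS) (hST ▸ hgi T hT)

theorem interior_ne_nil {r x : V} (hx : x ≠ r) (hrx : ∀ e : E, B.ends e ≠ s(r, x))
    {T : List B.OrientedEdge} (h : B.IsPath r T x) : ∃ v, v ∈ B.interior T := by
  match T, h.isWalk with
  | [], h => exact absurd (Eq.symm h) hx
  | [f], h => exact absurd (f.ends_eq.trans (by rw [h.1, show f.head = x from h.2])) (hrx f.edge)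
  | f :: g :: T, _ => exact ⟨_, head_mem_interior (S := []) (by simp)⟩

section Barrier

variable {C : Type*} {r x : V} {U : Set (V × ℤˣ)} {κ : V × ℤˣ → C}

/-- If `x` is reachable, take its blob for `X`. Every last edge into `x` stays in the blob, so
`N(x)` is contained in it, and paths enter it only at its base. One path then suffices. -/
theorem IsBarrier.exists_of_notMem_bases (hU : B.IsBarrier r U κ) (hx : x ≠ r)
    (hxb : x ∉ bases r U) :
    ∃ X : Set V, {x} ∪ B.inVertices r x ⊆ X ∧ r ∉ X ∧ ∃ P, B.IsInternallyDisjoint r x P ∧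
      (B.entryVertices r X).encard ≤ P.encard := by
  by_cases hpath : ∃ T, B.IsPath r T x
  · obtain ⟨T, hT⟩ := hpath
    obtain ⟨T₁, T₂, w, rfl, hw₁, hent, hw₂, hblob, hroot, -⟩ := hU.exists_decomposition hT
    have hxw := hblob x (right_mem_vertices hw₂)
    have hwr : w ≠ r := by
      rintro rfl
      have h₂ := hroot rfl
      subst h₂
      exact hx (Eq.symm hw₂)
    have hxU : ∀ s, (x, s) ∉ U := fun s h => hxb (Or.inr ⟨s, h⟩)
    refine ⟨{v | blob U κ v = blob U κ x}, ?_, fun h => ?_, {T₁ ++ T₂}, ⟨?_, ?_⟩, ?_⟩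
    · rintro v (rfl | ⟨hvr, hvx, T, f, hTf, rfl⟩)
      · rfl
      · exact (hU.blob_eq_of_notMem hTf (hxU _)).2.symm
    · exact hwr (hU.blob_injOn hent.mem_bases (Or.inl rfl) (hxw.symm.trans h.symm))
    · simpa using hT
    · simp
    · rw [Set.encard_singleton, ← Set.encard_singleton w]
      apply Set.encard_le_encard
      rintro v ⟨hvX, f, hfv, hft, T, hTf⟩
      have hv : (v, f.headSign) ∈ U := by
        by_contra hv
        exact hft ((hU.blob_eq_of_notMem hTf hv).2.symm.trans hvX)
      exact hU.blob_injOn (Or.inr ⟨_, hv⟩) hent.mem_bases (Eq.trans hvX hxw)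
  · refine ⟨{x}, ?_, fun h => hx h.symm, ∅, ⟨by simp, by simp⟩, ?_⟩
    · rintro v (rfl | ⟨hvr, hvx, T, f, hTf, rfl⟩)
      · rfl
      · exact absurd ⟨_, hTf⟩ hpath
    · rw [Set.encard_empty, nonpos_iff_eq_zero, Set.encard_eq_zero,
        Set.eq_empty_iff_forall_notMem]
      rintro v ⟨rfl, f, hfv, hft, T, hTf⟩
      exact hpath ⟨_, hTf⟩

/-- Menger's theorem is applied to the segment digraph between the out-neighbours of `r` and the
in-neighbours of `x`, so that the separator is met only by inner bases. `X` is the union of the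
blobs not reached from `r` in front of the separator `S`. -/
theorem IsBarrier.exists_of_mem_bases [Finite V] (hU : B.IsBarrier r U κ) (hx : x ≠ r)
    (hrx : ∀ e : E, B.ends e ≠ s(r, x)) (hxb : x ∈ bases r U) :
    ∃ X : Set V, {x} ∪ B.inVertices r x ⊆ X ∧ r ∉ X ∧ ∃ P, B.IsInternallyDisjoint r x P ∧
      (B.entryVertices r X).encard ≤ P.encard := by
  have hrb : r ∈ bases r U := Or.inl rfl
  set R := B.SegmentRel r U κ with hR
  let R' : V → V → Prop := fun u v => R u v ∧ v ≠ x
  let A : Set V := {a | R r a ∧ a ≠ x}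
  let D : Set V := {c | R c x}
  obtain ⟨S, hS, P, hP, hPd⟩ := exists_separates_and_linked R' A D
  have hRb : ∀ {u v}, R u v → v ∈ bases r U := fun h => h.choose_spec.right_mem
  have hRr : ∀ {u v}, R u v → v ≠ r := fun h => h.choose_spec.right_ne hU
  have hroute : ∀ {a s c}, Route R' a s c → a ∈ A → ∀ v ∈ s, v ∈ bases r U ∧ v ≠ r ∧ v ≠ x := by
    intro a s c h ha
    induction h with
    | refl =>
      rintro v rfl
      exact ⟨hRb ha.1, hRr ha.1, ha.2⟩
    | snoc _ hR _ ih =>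
      rintro v (rfl | hv)
      · exact ⟨hRb hR.1, hRr hR.1, hR.2⟩
      · exact ih v hv
  -- The bases reachable from `r` while avoiding `S` and `x`.
  let Z : Set V := {z | z = r ∨ ∃ a ∈ A, ∃ s, Route R' a s z ∧ ∀ v ∈ s, v ∉ S}
  have hZb : ∀ z ∈ Z, z ∈ bases r U ∧ z ≠ x := by
    rintro z (rfl | ⟨a, ha, s, hs, -⟩)
    · exact ⟨hrb, hx.symm⟩
    · have := hroute hs ha z hs.right_mem
      exact ⟨this.1, this.2.2⟩
  have hZstep : ∀ z ∈ Z, ∀ v, R z v → v ≠ x → v ∉ S → v ∈ Z := by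
    rintro z (rfl | ⟨a, ha, s, hs, hsS⟩) v hzv hvx hvS
    · exact Or.inr ⟨v, ⟨hzv, hvx⟩, _, .refl v, fun w hw => hw ▸ hvS⟩
    · by_cases hvs : v ∈ s
      · obtain ⟨s₁, -, h₁, -, hs₁, -⟩ := hs.split hvs
        exact Or.inr ⟨a, ha, s₁, h₁, fun w hw => hsS w (hs₁ hw)⟩
      · refine Or.inr ⟨a, ha, _, hs.snoc ⟨hzv, hvx⟩ hvs, ?_⟩
        rintro w (rfl | hw)
        · exact hvS
        · exact hsS w hw
  let X : Set V := {v | ∀ z ∈ Z, blob U κ v ≠ blob U κ z}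
  have hedge : ∀ T (f : B.OrientedEdge) v, B.IsPath r (T ++ [f]) v → (v, f.headSign) ∈ U →
      f.tail ∉ X → ∃ z ∈ Z, R z v ∧ (z = r → f.tail = r) := by
    intro T f v h hv hf
    simp only [X, Set.mem_ofPred_eq, not_forall, not_not] at hf
    obtain ⟨z, hz, hfz⟩ := hf
    obtain ⟨w, L, hL, hfw, hwr⟩ := hU.exists_isSegment h hv
    obtain rfl : w = z := hU.blob_injOn hL.left_mem (hZb z hz).1 (hfw.symm.trans hfz)
    exact ⟨w, hz, ⟨L, hL⟩, hwr⟩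
  have hNX : B.inVertices r x ⊆ X := by
    rintro v ⟨hvr, hvx, T, f, hTf, rfl⟩
    by_contra hX
    have hxU : (x, f.headSign) ∈ U := by
      by_contra h
      exact (hU.blob_eq_of_notMem hTf h).1 hxb
    -- A last edge into `x` from outside `X` gives a segment to `x` from a base in `Z`. That base is
    -- not `r`, since the tail would be `r`; otherwise a route to an in-neighbour of `x` would avoid
    -- `S`.
    obtain ⟨z, rfl | ⟨a, ha, s, hs, hsS⟩, hzx, hzr⟩ := hedge T f x hTf hxU hX
    · exact hvr (hzr rfl)
    · obtain ⟨v, hv, hvS⟩ := hS a ha z hzx s hs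
      exact hsS v hv hvS
  have hεS : B.entryVertices r X ⊆ S := by
    rintro v ⟨hvX, f, rfl, hft, T, hTf⟩
    have hv : (f.head, f.headSign) ∈ U := by
      by_contra hv
      refine hft fun z hz h => hvX z hz ?_
      rw [(hU.blob_eq_of_notMem hTf hv).2, h]
    obtain ⟨z, hz, hzv, -⟩ := hedge T f f.head hTf hv hft
    -- An entry vertex outside `S` would be reached from `Z` and so belong to `Z`; if it is `x`, the
    -- tail lies in `N(x)` and hence in `X`.
    by_contra hvS
    by_cases hvx : f.head = x
    · refine hft (hNX ⟨fun h => hrx f.edge (by rw [f.ends_eq, h, hvx]), hvx ▸ f.tail_ne_head,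
        T, f, hvx ▸ hTf, rfl⟩)
    · exact hvX _ (hZstep z hz _ hzv hvx hvS) rfl
  have hlift : ∀ i, ∃ T, B.IsPath r T x ∧
      ∀ v ∈ B.interior T, ∃ w ∈ P i, w ∈ bases r U ∧ blob U κ v = blob U κ w := by
    intro i
    obtain ⟨a, ha, c, hc, hac⟩ := hP i
    have hPi := hroute hac ha
    have h₁ := ((Route.refl (R := R) r).snoc ha.1 (hRr ha.1)).trans (hac.mono fun _ _ h => h.1) (by
      rintro v (rfl | rfl) hv
      · rfl
      · exact absurd rfl (hPi v hv).2.1)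
    have h₂ := h₁.snoc hc (by
      rintro ((h | h) | h)
      · exact ha.2 h.symm
      · exact hx h
      · exact (hPi x h).2.2 rfl)
    obtain ⟨T, hT, -, hinv⟩ := hU.exists_isPath_of_route h₂ rfl
    refine ⟨T, hT, fun v hv => ?_⟩
    obtain ⟨hvT, hvr, hvx⟩ := hT.mem_interior hv
    obtain ⟨⟨w, hw, hvw⟩, h2, h3⟩ := hinv v hvT
    rcases hw with rfl | (rfl | rfl) | hw
    · exact absurd (h2 hvw) hvx
    · exact ⟨w, hac.left_mem, (hPi w hac.left_mem).1, hvw⟩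
    · exact absurd (h3 hvw) hvr
    · exact ⟨w, hw, (hPi w hw).1, hvw⟩
  choose Q hQ hQi using hlift
  have hQd : ∀ i j, i ≠ j → List.Disjoint (B.interior (Q i)) (B.interior (Q j)) := by
    intro i j hij
    refine List.disjoint_left.2 fun v hi hj => ?_
    obtain ⟨w, hw, hwb, hvw⟩ := hQi i v hi
    obtain ⟨w', hw', hwb', hvw'⟩ := hQi j v hj
    obtain rfl := hU.blob_injOn hwb hwb' (hvw.symm.trans hvw')
    exact Set.disjoint_left.1 (hPd hij) hw hw'
  have hQinj : Function.Injective Q := by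
    intro i j hij
    by_contra hne
    obtain ⟨v, hv⟩ := interior_ne_nil hx hrx (hQ i)
    exact List.disjoint_left.1 (hQd i j hne) hv (hij ▸ hv)
  refine ⟨X, Set.union_subset ?_ hNX, fun h => h r (Or.inl rfl) rfl, Set.range Q, ⟨?_, ?_⟩, ?_⟩
  · rintro _ rfl z hz h
    exact (hZb z hz).2 (hU.blob_injOn hxb (hZb z hz).1 h).symm
  · rintro _ ⟨i, rfl⟩
    exact hQ i
  · rintro _ ⟨i, rfl⟩ _ ⟨j, rfl⟩ hij
    exact hQd i j fun h => hij (congrArg Q h)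
  · rw [← Set.image_univ, hQinj.encard_image, Set.encard_univ]
    refine (Set.encard_le_encard hεS).trans (le_of_eq ?_)
    rw [Set.encard_coe_eq_coe_finsetCard, ENat.card_eq_coe_fintype_card, Fintype.card_coe]

end Barrier

end BidirectedGraph

theorem mainTheorem6 {V E : Type*} [Finite V] [Finite E] (B : BidirectedGraph V E) (r x : V)
    (hclean : B.IsClean r) (hx : x ≠ r) (hrx : ∀ e : E, B.ends e ≠ s(r, x)) :
    (∃ P : Set (List B.OrientedEdge), B.IsInternallyDisjoint r x P ∧ P.encard = B.kappa r x) ∧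
      IsLeast
        {n : ℕ∞ | ∃ X : Set V, {x} ∪ B.inVertices r x ⊆ X ∧ r ∉ X ∧
          n = (B.entryVertices r X).encard}
        (B.kappa r x) := by
  obtain ⟨C, U, κ, hU⟩ := hclean.exists_isBarrier
  have hex : ∃ X : Set V, {x} ∪ B.inVertices r x ⊆ X ∧ r ∉ X ∧
      ∃ P, B.IsInternallyDisjoint r x P ∧ (B.entryVertices r X).encard ≤ P.encard := by
    by_cases hxb : x ∈ BidirectedGraph.bases r U
    · exact hU.exists_of_mem_bases hx hrx hxb
    · exact hU.exists_of_notMem_bases hx hxb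
  obtain ⟨X, hX, hrX, P, hP, hXP⟩ := hex
  have hle : ∀ Y : Set V, {x} ∪ B.inVertices r x ⊆ Y → r ∉ Y →
      B.kappa r x ≤ (B.entryVertices r Y).encard := fun Y hY hrY =>
    iSup_le fun Q => Q.2.encard_le hrx hY hrY
  have hPk : P.encard ≤ B.kappa r x :=
    le_iSup (fun Q : {Q // B.IsInternallyDisjoint r x Q} => Q.1.encard) ⟨P, hP⟩
  -- The chain `|ε(X)| ≤ |P| ≤ κ ≤ |ε(X)|` shows that both the maximum and the minimum are attained.
  refine ⟨⟨P, hP, le_antisymm hPk ((hle X hX hrX).trans hXP)⟩,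
    ⟨X, hX, hrX, le_antisymm (hle X hX hrX) (hXP.trans hPk)⟩, ?_⟩
  rintro _ ⟨Y, hY, hrY, rfl⟩
  exact hle Y hY hrY
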